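/- Let $\mathcal C,\mathcal S:\mathbb R\to\mathbb R$ be the $1$-periodic functions with $\mathcal C(x)=4|x-\frac12|-1$ and $\mathcal S(x)=\bigl|2-4|x-\frac14|\bigr|-1$ for $x\in[0,1)$. For $k\in\mathbb Z^d$ write $k\triangleright 0$ if $k\neq 0$ and the first non-zero entry of $k$ is positive. For $t\ge 0$ let $N(t,d)=\#\{k\in\mathbb Z^d:\|k\|_2\le t\}$. For $s>0$ let $W^s([0,1]^d)$ be the set of real-valued $f\in L_2([0,1]^d)$ whose Fourier coefficients $a_m=\int_{[0,1]^d}f(x)e^{-2\pi i m\cdot x}\,dx$ satisfy $\|f\|_{W^s}^2:=|a_0|^2+\sum_{m\in\mathbb Z^d\setminus\{0\}}\|m\|_2^{2s}|a_m|^2<\infty$. A ReLU network of width $W\ge1$ and depth $L\ge1$ with input dimension $d$ consists of affine maps $A^{(0)}:\mathbb R^d\to\mathbb R^W$, $A^{(j)}:\mathbb R^W\to\mathbb R^W$ ($1\le j\le L-1$) and $A^{(L)}:\mathbb R^W\to\mathbb R$, and generates the function $A^{(L)}\circ\mathrm{ReLU}\circ A^{(L-1)}\circ\cdots\circ\mathrm{ReLU}\circ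 A^{(0)}$, where $\mathrm{ReLU}(x)=\max\{x,0\}$ acts coordinatewise. **Theorem.** Let $0<s<1$. There is a constant $C_s>0$, depending only on $s$, such that the following holds for every integer $d\ge1$ and every $0<\varepsilon<1$. Put $R=(C_s/\varepsilon)^{1/s}$ and $W=4\,N(R,d)$. There are an integer $L\ge 1$ with $$L\le 4+\log_2\bigl(R\sqrt{\min(R,d)}\bigr)$$ and, for every tuple of real coefficients $c=(\alpha_0,(\alpha_k)_k,(\beta_k)_k)$ indexed by the $k\triangleright0$ with $\|k\|_2\le R$, a ReLU network $\mathcal N_c$ of width $W$ and depth $L$ with input dimension $d$, such that: 1. the affine maps $A^{(0)},\dots,A^{(L-1)}$ of $\mathcal N_c$ do not depend on $c$, and the weights and the bias of $A^{(L)}$ depend linearly on $c$; 2. $\mathcal N_c(x)=\alpha_0+\sum_{k\triangleright0,\ \|k\|_2\le R}\bigl[\alpha_k\mathcal C(k\cdot x)+\beta_k\mathcal S(k\cdot x)\bigr]$ for all $c$ and all $x\in[0,1]^d$; 3. every $f\in W^s([0,1]^d)$ has an expansion $f=\alpha_0+\sum_{k\triangleright0}\bigl[\alpha_k\,\mathcal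 C(k\cdot x)+\beta_k\,\mathcal S(k\cdot x)\bigr]$ with real coefficients, converging unconditionally in $L_2([0,1]^d)$, such that for $c=(\alpha_0,(\alpha_k)_{\|k\|_2\le R},(\beta_k)_{\|k\|_2\le R})$ $$\|f-\mathcal N_c\|_{L_2([0,1]^d)}\le\varepsilon\,\|f\|_{W^s}.$$ In particular $L$, and with it the architecture of the network, is independent of $f$. -/

import Mathlib

open MeasureTheory Filter Topology

noncomputable section

namespace ReLUApprox

/-- The Euclidean norm `‖k‖₂` of an integer vector. -/
def norm2 {d : ℕ} (k : Fin d → ℤ) : ℝ := Real.sqrt (∑ i, (k i : ℝ) ^ 2)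

/-- The set `Z(t,d)` of the integer points in the Euclidean ball of radius `t`. -/
def latticeBall (t : ℝ) (d : ℕ) : Set (Fin d → ℤ) := {k | norm2 k ≤ t}

theorem latticeBall_finite (t : ℝ) (d : ℕ) : (latticeBall t d).Finite := by
  refine (Set.finite_Icc (fun _ : Fin d => -⌈t⌉) (fun _ => ⌈t⌉)).subset ?_
  intro k hk
  have h : ∀ i, |(k i : ℝ)| ≤ t := fun i =>
    (Real.abs_le_sqrt (Finset.single_le_sum (f := fun i => (k i : ℝ) ^ 2)
      (fun j _ => sq_nonneg _) (Finset.mem_univ i))).trans hk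
  refine ⟨fun i => ?_, fun i => ?_⟩
  · have h1 : -(⌈t⌉ : ℝ) ≤ (k i : ℝ) := by
      linarith [(abs_le.mp (h i)).1, Int.le_ceil t]
    exact_mod_cast h1
  · have h1 : (k i : ℝ) ≤ (⌈t⌉ : ℝ) := (abs_le.mp (h i)).2.trans (Int.le_ceil t)
    exact_mod_cast h1

/-- The number `N(t,d)` of integer points in the Euclidean ball of radius `t` (a finite set). -/
def latticeCount (t : ℝ) (d : ℕ) : ℕ := (latticeBall t d).ncard

/-- `k ▷ 0`: `k` is non-zero and its first non-zero entry is positive. -/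
def FirstPos {d : ℕ} (k : Fin d → ℤ) : Prop := ∃ i, 0 < k i ∧ ∀ j < i, k j = 0

open Classical in
/-- The finite set of all `k ▷ 0` with `‖k‖₂ ≤ t`. -/
def posBall (t : ℝ) (d : ℕ) : Finset (Fin d → ℤ) :=
  (latticeBall_finite t d).toFinset.filter FirstPos

/-- The usual inner product `k · x`. -/
def dotZ {d : ℕ} (k : Fin d → ℤ) (x : Fin d → ℝ) : ℝ := ∑ i, (k i : ℝ) * x i

/-- The one-periodic piecewise linear function `𝒞` interpolating the cosine. -/
def triCos (x : ℝ) : ℝ := 4 * |Int.fract x - 1 / 2| - 1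

/-- The one-periodic piecewise linear function `𝒮` interpolating the sine. -/
def triSin (x : ℝ) : ℝ := |2 - 4 * (|Int.fract x - 1 / 4|)| - 1

/-- The unit cube `[0,1]^d`. -/
def cube (d : ℕ) : Set (Fin d → ℝ) := Set.Icc 0 1

/-- The `L₂([0,1]^d)`-norm (with values in `[0,∞]`). -/
def l2Norm {d : ℕ} (g : (Fin d → ℝ) → ℝ) : ENNReal :=
  eLpNorm g 2 (volume.restrict (cube d))

/-- The Fourier coefficient `a_m` of a real function on the unit cube. -/
def fourierCoef {d : ℕ} (f : (Fin d → ℝ) → ℝ) (m : Fin d → ℤ) : ℂ :=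
  ∫ x in cube d, (f x : ℂ) * Complex.exp (-(2 * Real.pi * Complex.I * (dotZ m x : ℂ)))

/-- `f` is a real-valued element of the periodic Sobolev space `W^s([0,1]^d)`. -/
structure MemSobolev {d : ℕ} (s : ℝ) (f : (Fin d → ℝ) → ℝ) : Prop where
  memLp : MemLp f 2 (volume.restrict (cube d))
  summable : Summable fun m : {m : Fin d → ℤ // m ≠ 0} =>
    norm2 m.1 ^ (2 * s) * ‖fourierCoef f m.1‖ ^ 2

/-- The norm of `W^s([0,1]^d)`. -/
def sobolevNorm {d : ℕ} (s : ℝ) (f : (Fin d → ℝ) → ℝ) : ℝ :=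
  Real.sqrt (‖fourierCoef f 0‖ ^ 2 +
    ∑' m : {m : Fin d → ℤ // m ≠ 0}, norm2 m.1 ^ (2 * s) * ‖fourierCoef f m.1‖ ^ 2)

/-- `f = α₀ + ∑_{k ▷ 0} (α_k 𝒞(k · x) + β_k 𝒮(k · x))`, with unconditional convergence in
`L₂([0,1]^d)`. Only the values of `α` and `β` at the `k ▷ 0` matter. -/
def HasTriExpansion {d : ℕ} (f : (Fin d → ℝ) → ℝ) (α₀ : ℝ) (α β : (Fin d → ℤ) → ℝ) : Prop :=
  Tendsto (fun F : Finset {k : Fin d → ℤ // FirstPos k} =>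
    l2Norm fun x => f x -
      (α₀ + ∑ k ∈ F, (α k.1 * triCos (dotZ k.1 x) + β k.1 * triSin (dotZ k.1 x))))
    atTop (𝓝 0)

/-- The coefficients `α₀`, `α_k`, `β_k` with `k ▷ 0` and `‖k‖₂ ≤ t`. -/
abbrev TriCoeffs (t : ℝ) (d : ℕ) : Type := ℝ × (posBall t d → ℝ) × (posBall t d → ℝ)

/-- The partial sum with given coefficients. -/
def partialSum {t : ℝ} {d : ℕ} (c : TriCoeffs t d) (x : Fin d → ℝ) : ℝ :=
  c.1 + ∑ k : posBall t d,
    (c.2.1 k * triCos (dotZ k.1 x) + c.2.2 k * triSin (dotZ k.1 x))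

/-- Restriction of coefficient families to the `k ▷ 0` with `‖k‖₂ ≤ t`. -/
def truncate (t : ℝ) {d : ℕ} (α₀ : ℝ) (α β : (Fin d → ℤ) → ℝ) : TriCoeffs t d :=
  (α₀, fun k => α k.1, fun k => β k.1)

/-- The affine maps `A⁽⁰⁾ : ℝ^d → ℝ^W` (`inWeight`, `inBias`) and `A⁽ʲ⁾ : ℝ^W → ℝ^W`,
`j = 1, …, L - 1` (`midWeight`, `midBias`), of a network of width `W` and depth `L ≥ 1`. -/
structure HiddenLayers (d W L : ℕ) where
  inWeight : Matrix (Fin W) (Fin d) ℝ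
  inBias : Fin W → ℝ
  midWeight : Fin (L - 1) → Matrix (Fin W) (Fin W) ℝ
  midBias : Fin (L - 1) → Fin W → ℝ

/-- A feed-forward ReLU network with `d` inputs, one output, width `W` and depth `L ≥ 1`: the
hidden layers together with the last affine map `A⁽ᴸ⁾ : ℝ^W → ℝ`. -/
structure ReLUNetwork (d W L : ℕ) extends HiddenLayers d W L where
  outWeight : Fin W → ℝ
  outBias : ℝ

/-- The activation function, applied coordinatewise. -/
def relu {W : ℕ} (v : Fin W → ℝ) : Fin W → ℝ := fun i => max (v i) 0

/-- `ReLU ∘ A⁽ᴸ⁻¹⁾ ∘ ⋯ ∘ ReLU ∘ A⁽⁰⁾`. -/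
def HiddenLayers.eval {d W L : ℕ} (N : HiddenLayers d W L) (x : Fin d → ℝ) : Fin W → ℝ :=
  Fin.foldl (L - 1) (fun v j => relu ((N.midWeight j).mulVec v + N.midBias j))
    (relu (N.inWeight.mulVec x + N.inBias))

/-- The function `A⁽ᴸ⁾ ∘ ReLU ∘ A⁽ᴸ⁻¹⁾ ∘ ⋯ ∘ ReLU ∘ A⁽⁰⁾` generated by the network. -/
def ReLUNetwork.eval {d W L : ℕ} (N : ReLUNetwork d W L) (x : Fin d → ℝ) : ℝ :=
  (∑ i, N.outWeight i * N.toHiddenLayers.eval x i) + N.outBias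

end ReLUApprox

end

open MeasureTheory Filter Topology

/-! The idea is to treat triangle waves as the image of the exponentials under an invertible
operator that commutes well with frequency truncation. Let `e_k` be the Fourier basis of `L₂` of the
torus and `D_j` the isometry `e_k ↦ e_{jk}`. The wave `𝒞 + i𝒮` has the Fourier series `(8/π²) ∑ n⁻²
e(χ₄(n) n x)` over odd `n` (`hasSum_triExp`), so `Z = ∑ n⁻² D_{χ₄(n)n}` maps `e_k` to `π²/8` times
the triangle wave of frequency `k` (`zetaOp_mFourierBasis`). Since `n ↦ D_{χ₄(n)n}` is completely
multiplicative, `Z` is inverted as a Dirichlet series is, by `M = ∑ μ(n) n⁻² D_{χ₄(n)n}`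
(`tsum_mul_tsum_moebius`). Applying `Z` to the Fourier series of `M f` gives an unconditionally
convergent triangle expansion of `f`.

The error of the partial sum over `‖k‖₂ ≤ R` is `Z` applied to the Fourier tail of `M f`. The tail
of `D_j f` beyond `R` is `D_j` of the tail of `f` beyond `R/|j|`, which costs a factor `(n/R)^s`
when `|j| ≤ n`. The sum `∑ n^(s-2)` is finite because `s < 1`, and the error is at most a constant
times `R^(-s) ‖f‖` (`norm_sub_moebius_expansion_le`). Pairing `k` with `-k` and taking real parts
yields the real expansion.

For the network, the distance to the nearest integer satisfies `distZ (4 * distZ x) = distZ (4 *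
x)`, and on `[0, 1/2]` the map `y ↦ distZ (4 * y)` is a combination of four ReLUs. Four neurons per
lattice point therefore multiply the frequency by `4` in each layer. As `|k · x| ≤ ‖k‖₂² ≤ R²` on
the cube, about `log₄ R² = log₂ R` layers suffice (`eval_waveLayers`, `eval_waveNetwork`). -/

namespace ReLUApprox

/-! ### Möbius inversion in a Banach algebra. -/

section Moebius

variable {A : Type*} [NormedRing A] [NormedAlgebra ℂ A]

/-- Absolute convergence of `∑ cₙ n⁻² wₙ` for bounded `c` and `w`. -/
theorem summable_norm_smul_div_sq (w : ℕ →* A) (hw : ∀ n, ‖w n‖ ≤ 1) (c : ℕ → ℂ)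
    (hc : ∀ n, ‖c n‖ ≤ 1) :
    Summable fun n : ℕ => ‖(c n * ((n : ℂ) ^ 2)⁻¹) • w n‖ := by
  refine Summable.of_nonneg_of_le (fun _ => norm_nonneg _) (fun n => ?_)
    (Real.summable_nat_pow_inv.2 (by norm_num : 1 < 2))
  rw [norm_smul, norm_mul, norm_inv, norm_pow, Complex.norm_natCast]
  have h : 0 ≤ ((n : ℝ) ^ 2)⁻¹ := by positivity
  calc ‖c n‖ * ((n : ℝ) ^ 2)⁻¹ * ‖w n‖ ≤ 1 * ((n : ℝ) ^ 2)⁻¹ * 1 := by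
        gcongr
        · exact hc n
        · exact hw n
    _ = ((n : ℝ) ^ 2)⁻¹ := by ring

theorem norm_moebius_le_one (n : ℕ) : ‖((ArithmeticFunction.moebius n : ℤ) : ℂ)‖ ≤ 1 := by
  rw [Complex.norm_intCast]
  exact_mod_cast ArithmeticFunction.abs_moebius_le_one

/-- Möbius inversion for the Dirichlet series of a bounded completely multiplicative sequence in a
Banach algebra. -/
theorem tsum_mul_tsum_moebius [CompleteSpace A] (w : ℕ →* A) (hw : ∀ n, ‖w n‖ ≤ 1) :
    (∑' n : ℕ, ((n : ℂ) ^ 2)⁻¹ • w n) *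
      (∑' n : ℕ, (((ArithmeticFunction.moebius n : ℤ) : ℂ) * ((n : ℂ) ^ 2)⁻¹) • w n) = 1 := by
  have h1 : Summable fun n : ℕ => ‖((n : ℂ) ^ 2)⁻¹ • w n‖ := by
    simpa using summable_norm_smul_div_sq w hw (fun _ => 1) (by simp)
  have h2 := summable_norm_smul_div_sq w hw _ norm_moebius_le_one
  have key : ∀ p : ℕ × ℕ, ((p.1 : ℂ) ^ 2)⁻¹ • w p.1 *
      (((ArithmeticFunction.moebius p.2 : ℤ) : ℂ) * ((p.2 : ℂ) ^ 2)⁻¹) • w p.2 =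
      ((ArithmeticFunction.moebius p.2 : ℤ) : ℂ) •
        ((((p.1 * p.2 : ℕ) : ℂ) ^ 2)⁻¹ • w (p.1 * p.2)) := by
    intro p
    rw [smul_mul_smul_comm, ← map_mul, smul_smul]
    congr 1
    push_cast
    rw [mul_pow, mul_inv]
    ring
  rw [tsum_mul_tsum_of_summable_norm h1 h2]
  have hs := (summable_mul_of_summable_norm h1 h2).hasSum
  -- The double series is grouped by the product `N = p.1 * p.2`. The group of `N` carries the
  -- factor `∑_{n ∣ N} μ(n)`, so only `N = 1` survives.
  rw [← (hs.tsum_fiberwise fun p => p.1 * p.2).tsum_eq, tsum_eq_single 1]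
  · have : (fun p : ℕ × ℕ => p.1 * p.2) ⁻¹' {1} = {(1, 1)} := by
      ext p
      simp [Prod.ext_iff]
    rw [this, tsum_singleton (1, 1) (fun p : ℕ × ℕ => ((p.1 : ℂ) ^ 2)⁻¹ • w p.1 *
      (((ArithmeticFunction.moebius p.2 : ℤ) : ℂ) * ((p.2 : ℂ) ^ 2)⁻¹) • w p.2)]
    simp
  · intro N hN
    -- The fibre over `0` is infinite, but each of its terms vanishes because `0⁻¹ = 0`.
    rcases eq_or_ne N 0 with rfl | hN0
    · refine (tsum_congr fun p => ?_).trans tsum_zero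
      have hp : p.1.1 * p.1.2 = 0 := p.2
      rw [key, hp]
      simp
    · have : (fun p : ℕ × ℕ => p.1 * p.2) ⁻¹' {N} = ↑(N.divisorsAntidiagonal) := by
        ext p
        simp [hN0]
      rw [this, Finset.tsum_subtype' N.divisorsAntidiagonal
        (fun p : ℕ × ℕ => ((p.1 : ℂ) ^ 2)⁻¹ • w p.1 *
          (((ArithmeticFunction.moebius p.2 : ℤ) : ℂ) * ((p.2 : ℂ) ^ 2)⁻¹) • w p.2)]
      have : ∀ p ∈ N.divisorsAntidiagonal, ((p.1 : ℂ) ^ 2)⁻¹ • w p.1 *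
          (((ArithmeticFunction.moebius p.2 : ℤ) : ℂ) * ((p.2 : ℂ) ^ 2)⁻¹) • w p.2 =
          ((ArithmeticFunction.moebius p.2 : ℤ) : ℂ) • (((N : ℂ) ^ 2)⁻¹ • w N) := by
        intro p hp
        rw [key, (Nat.mem_divisorsAntidiagonal.1 hp).1]
      rw [Finset.sum_congr rfl this, ← Finset.sum_smul,
        Nat.sum_divisorsAntidiagonal' (fun _ n => ((ArithmeticFunction.moebius n : ℤ) : ℂ)),
        ← Int.cast_sum, ← ArithmeticFunction.coe_mul_zeta_apply,
        ArithmeticFunction.moebius_mul_coe_zeta, ArithmeticFunction.one_apply_ne hN]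
      simp

end Moebius

/-! ### Dilation operators, their Dirichlet series, and Fourier truncation. -/

section Dilation

variable {ι : Type*} [AddCommGroup ι] [Module.IsTorsionFree ℤ ι] {H : Type*}
  [NormedAddCommGroup H] [InnerProductSpace ℂ H] [CompleteSpace H] (b : HilbertBasis ι ℂ H)

theorem clm_ext_hilbertBasis {ι H : Type*} [NormedAddCommGroup H] [InnerProductSpace ℂ H]
    (b : HilbertBasis ι ℂ H) {S T : H →L[ℂ] H} (h : ∀ k, S (b k) = T (b k)) : S = T :=
  ContinuousLinearMap.ext_on
    (Submodule.dense_iff_topologicalClosure_eq_top.2 b.dense_span)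
    (by rintro _ ⟨k, rfl⟩; exact h k)

open Classical in
/-- The isometry `e_k ↦ e_{jk}` for `j ≠ 0`, and zero for `j = 0`. -/
noncomputable def dilation (j : ℤ) : H →L[ℂ] H :=
  if hj : j ≠ 0 then
    ((b.orthonormal.comp (fun k : ι => j • k)
      (smul_right_injective ι hj)).orthogonalFamily.linearIsometry.comp
        b.repr.toLinearIsometry).toContinuousLinearMap
  else 0

theorem dilation_zero : dilation b 0 = 0 := by simp [dilation]

theorem norm_dilation_apply_le (j : ℤ) (x : H) : ‖dilation b j x‖ ≤ ‖x‖ := by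
  by_cases hj : j ≠ 0
  · simp [dilation, hj]
  · simp [dilation, hj]

theorem norm_dilation_le (j : ℤ) : ‖dilation b j‖ ≤ 1 :=
  ContinuousLinearMap.opNorm_le_bound _ zero_le_one fun x => by
    simpa using norm_dilation_apply_le b j x

theorem dilation_basis {j : ℤ} (hj : j ≠ 0) (k : ι) : dilation b j (b k) = b (j • k) := by
  classical
  simp [dilation, hj, HilbertBasis.repr_self]

theorem dilation_one : dilation b 1 = 1 :=
  clm_ext_hilbertBasis b fun k => by simp [dilation_basis]

theorem dilation_mul (i j : ℤ) : dilation b (i * j) = dilation b i * dilation b j := by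
  rcases eq_or_ne i 0 with rfl | hi
  · simp [dilation_zero]
  rcases eq_or_ne j 0 with rfl | hj
  · simp [dilation_zero]
  refine clm_ext_hilbertBasis b fun k => ?_
  simp [dilation_basis, hi, hj, mul_smul]

/-- The sequence `n ↦ dilation (χ₄(n) n)`, where `χ₄` is the non-trivial character modulo `4`. -/
noncomputable def signedDilation : ℕ →* (H →L[ℂ] H) where
  toFun n := dilation b (ZMod.χ₄ n * n)
  map_one' := by simp [dilation_one]
  map_mul' m n := by
    rw [← dilation_mul]
    congr 1
    push_cast
    rw [map_mul]
    ring

/-- The truncation operator that removes the coordinates in `F`. -/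
noncomputable def tailProj {ι H : Type*} [NormedAddCommGroup H] [InnerProductSpace ℂ H]
    (b : HilbertBasis ι ℂ H) (F : Finset ι) : H →L[ℂ] H :=
  1 - ∑ k ∈ F, (innerSL ℂ (b k)).smulRight (b k)

theorem tailProj_apply {ι H : Type*} [NormedAddCommGroup H] [InnerProductSpace ℂ H]
    (b : HilbertBasis ι ℂ H) (F : Finset ι) (x : H) :
    tailProj b F x = x - ∑ k ∈ F, b.repr x k • b k := by
  simp [tailProj, b.repr_apply_apply]

open Classical in
theorem repr_tailProj {ι H : Type*} [NormedAddCommGroup H] [InnerProductSpace ℂ H]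
    (b : HilbertBasis ι ℂ H) (F : Finset ι) (x : H) (m : ι) :
    b.repr (tailProj b F x) m = if m ∈ F then 0 else b.repr x m := by
  have h := orthonormal_iff_ite.1 b.orthonormal
  rw [tailProj_apply, b.repr_apply_apply, inner_sub_right, inner_sum]
  simp only [inner_smul_right, h, mul_ite, mul_one, mul_zero, Finset.sum_ite_eq]
  split_ifs <;> simp [b.repr_apply_apply]

open Classical in
theorem tailProj_basis {ι H : Type*} [NormedAddCommGroup H] [InnerProductSpace ℂ H]
    (b : HilbertBasis ι ℂ H) (F : Finset ι) (k : ι) :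
    tailProj b F (b k) = if k ∈ F then 0 else b k := by
  rw [tailProj_apply]
  have : ∀ i ∈ F, b.repr (b k) i • b i = if i = k then b k else 0 := by
    intro i _
    rw [b.repr_apply_apply, orthonormal_iff_ite.1 b.orthonormal]
    split_ifs with h <;> simp [h]
  rw [Finset.sum_congr rfl this, Finset.sum_ite_eq']
  split_ifs <;> simp

/-- `D_j` moves coordinate `k` to `j • k`, so removing `F` afterwards is the same as removing its
preimage beforehand. For a ball this divides the radius by `|j|`, which is the source of the rate.
-/
theorem tailProj_dilation {j : ℤ} (hj : j ≠ 0) (F : Finset ι) (x : H) :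
    tailProj b F (dilation b j x) =
      dilation b j (tailProj b (F.preimage (fun k => j • k)
        (smul_right_injective ι hj).injOn) x) := by
  classical
  have : tailProj b F * dilation b j = dilation b j * tailProj b (F.preimage (fun k => j • k)
      (smul_right_injective ι hj).injOn) := by
    refine clm_ext_hilbertBasis b fun k => ?_
    simp only [mul_apply_eq_comp, dilation_basis b hj, tailProj_basis,
      Finset.mem_preimage]
    split_ifs <;> simp [dilation_basis b hj]
  exact DFunLike.congr_fun this x

theorem hasSum_norm_sq_repr {ι H : Type*} [NormedAddCommGroup H] [InnerProductSpace ℂ H]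
    (b : HilbertBasis ι ℂ H) (x : H) : HasSum (fun k => ‖b.repr x k‖ ^ 2) (‖x‖ ^ 2) := by
  have h := lp.hasSum_norm (p := 2) (by norm_num) (b.repr x)
  simpa using h

/-- Parseval, with each surviving coefficient majorised by its weighted version. -/
theorem norm_tailProj_sq_le {ι H : Type*} [NormedAddCommGroup H] [InnerProductSpace ℂ H]
    (b : HilbertBasis ι ℂ H) (F : Finset ι) (x : H) (w : ι → ℝ) (c : ℝ) (hc : 0 ≤ c)
    (hw : ∀ k, 0 ≤ w k) (hF : ∀ k ∉ F, 1 ≤ c * w k)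
    (hs : Summable fun k => w k * ‖b.repr x k‖ ^ 2) :
    ‖tailProj b F x‖ ^ 2 ≤ c * ∑' k, w k * ‖b.repr x k‖ ^ 2 := by
  classical
  refine hasSum_le (fun k => ?_) (hasSum_norm_sq_repr b (tailProj b F x)) (hs.hasSum.mul_left c)
  rw [repr_tailProj]
  split_ifs with hk
  · have := hw k
    rw [norm_zero, zero_pow two_ne_zero]
    positivity
  · rw [← mul_assoc]
    nlinarith [hF k hk, sq_nonneg ‖b.repr x k‖]

theorem norm_signedDilation_le (n : ℕ) : ‖signedDilation b n‖ ≤ 1 := norm_dilation_le b _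

/-- The operator `∑ n⁻² D_{χ₄(n) n}`. -/
noncomputable def zetaOp : H →L[ℂ] H := ∑' n : ℕ, ((n : ℂ) ^ 2)⁻¹ • signedDilation b n

/-- The operator `∑ μ(n) n⁻² D_{χ₄(n) n}`, inverse to `zetaOp`. -/
noncomputable def moebiusOp : H →L[ℂ] H :=
  ∑' n : ℕ, (((ArithmeticFunction.moebius n : ℤ) : ℂ) * ((n : ℂ) ^ 2)⁻¹) • signedDilation b n

/-- Surjectivity with an explicit right inverse is all the expansion needs; uniqueness of the
coefficients plays no role. -/
theorem zetaOp_moebiusOp (x : H) : zetaOp b (moebiusOp b x) = x :=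
  DFunLike.congr_fun (tsum_mul_tsum_moebius (signedDilation b) (norm_signedDilation_le b)) x

theorem summable_norm_zetaOp :
    Summable fun n : ℕ => ‖((n : ℂ) ^ 2)⁻¹ • signedDilation b n‖ := by
  simpa using summable_norm_smul_div_sq _ (norm_signedDilation_le b) (fun _ => 1) (by simp)

theorem norm_zetaOp_le : ‖zetaOp b‖ ≤ ∑' n : ℕ, ((n : ℝ) ^ 2)⁻¹ := by
  refine tsum_of_norm_bounded
    (Real.summable_nat_pow_inv.2 (by norm_num : 1 < 2)).hasSum fun n => ?_
  rw [norm_smul, norm_inv, norm_pow, Complex.norm_natCast]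
  exact mul_le_of_le_one_right (by positivity) (norm_signedDilation_le b n)

theorem hasSum_zetaOp_basis (k : ι) :
    HasSum (fun n : ℕ => ((n : ℂ) ^ 2)⁻¹ • signedDilation b n (b k)) (zetaOp b (b k)) := by
  have h : HasSum _ (zetaOp b) := (summable_norm_zetaOp b).of_norm.hasSum
  simpa using (ContinuousLinearMap.apply ℂ H (b k)).hasSum h

/-- Every vector is an unconditionally convergent series in the vectors `zetaOp b (b k)`. -/
theorem hasSum_moebius_expansion (x : H) :
    HasSum (fun k => b.repr (moebiusOp b x) k • zetaOp b (b k)) x := by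
  simpa [zetaOp_moebiusOp] using (zetaOp b).hasSum (b.hasSum_repr (moebiusOp b x))

theorem sub_sum_moebius_expansion (F : Finset ι) (x : H) :
    x - ∑ k ∈ F, b.repr (moebiusOp b x) k • zetaOp b (b k) =
      zetaOp b (tailProj b F (moebiusOp b x)) := by
  simp [tailProj_apply, zetaOp_moebiusOp]

theorem norm_tailProj_moebiusOp_le (F : Finset ι) (x : H) (t : ℕ → ℝ)
    (ht : Summable fun n : ℕ => ((n : ℝ) ^ 2)⁻¹ * t n)
    (h : ∀ n, ‖tailProj b F (signedDilation b n x)‖ ≤ t n) :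
    ‖tailProj b F (moebiusOp b x)‖ ≤ ∑' n : ℕ, ((n : ℝ) ^ 2)⁻¹ * t n := by
  have h0 : HasSum _ (moebiusOp b) :=
    (summable_norm_smul_div_sq _ (norm_signedDilation_le b) _ norm_moebius_le_one).of_norm.hasSum
  have h1 := (tailProj b F).hasSum ((ContinuousLinearMap.apply ℂ H x).hasSum h0)
  have h2 : (tailProj b F) ((ContinuousLinearMap.apply ℂ H x) (moebiusOp b)) =
    tailProj b F (moebiusOp b x) := rfl
  rw [← h2, ← h1.tsum_eq]
  refine tsum_of_norm_bounded ht.hasSum fun n => ?_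
  simp only [ContinuousLinearMap.apply_apply, map_smul, norm_smul, norm_mul, norm_inv, norm_pow,
    Complex.norm_natCast]
  have h3 : 0 ≤ ((n : ℝ) ^ 2)⁻¹ := by positivity
  calc ‖((ArithmeticFunction.moebius n : ℤ) : ℂ)‖ * ((n : ℝ) ^ 2)⁻¹ *
        ‖tailProj b F (signedDilation b n x)‖ ≤ 1 * ((n : ℝ) ^ 2)⁻¹ * t n := by
        gcongr
        · exact norm_moebius_le_one n
        · exact h n
    _ = _ := by ring

end Dilation

/-! ### The approximation rate for truncation to a ball. -/

section Lattice

variable {d : ℕ}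

theorem norm2_smul (j : ℤ) (k : Fin d → ℤ) : norm2 (j • k) = |(j : ℝ)| * norm2 k := by
  rw [norm2, norm2, ← Real.sqrt_sq_eq_abs, ← Real.sqrt_mul (sq_nonneg _), Finset.mul_sum]
  simp [mul_pow]

theorem norm2_nonneg (k : Fin d → ℤ) : 0 ≤ norm2 k := Real.sqrt_nonneg _

theorem norm2_zero : norm2 (0 : Fin d → ℤ) = 0 := by simp [norm2]

theorem abs_chi_four_mul_le (n : ℕ) : |((ZMod.χ₄ n * n : ℤ) : ℝ)| ≤ n := by
  have h : |ZMod.χ₄ (n : ZMod 4)| ≤ 1 := by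
    generalize (n : ZMod 4) = m
    revert m
    decide
  have h' : |((ZMod.χ₄ (n : ZMod 4) : ℤ) : ℝ)| ≤ 1 := by exact_mod_cast h
  push_cast
  rw [abs_mul, Nat.abs_cast]
  exact mul_le_of_le_one_left (Nat.cast_nonneg n) h'

variable {H : Type*} [NormedAddCommGroup H] [InnerProductSpace ℂ H] [CompleteSpace H]
  (b : HilbertBasis (Fin d → ℤ) ℂ H)

/-- After commuting with the dilation by `j`, only frequencies with `|j| * norm2 k > R` remain. As
`|j| ≤ n`, the weight `((n / R) * norm2 k) ^ (2 * s)` is at least `1` there. -/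
theorem norm_tailProj_signedDilation_le {s R : ℝ} (hs : 0 < s) (hR : 0 < R)
    (F : Finset (Fin d → ℤ)) (hF : ∀ k, k ∈ F ↔ norm2 k ≤ R) (x : H)
    (hx : Summable fun k => norm2 k ^ (2 * s) * ‖b.repr x k‖ ^ 2) (n : ℕ) :
    ‖tailProj b F (signedDilation b n x)‖ ≤
      ((n : ℝ) / R) ^ s * Real.sqrt (∑' k, norm2 k ^ (2 * s) * ‖b.repr x k‖ ^ 2) := by
  have hnn : (0 : ℝ) ≤ (n : ℝ) / R := by positivity
  change ‖tailProj b F (dilation b (ZMod.χ₄ n * n) x)‖ ≤ _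
  -- This covers even `n`, including `n = 0`, where the dilation is zero by definition.
  by_cases hj : ZMod.χ₄ n * n = (0 : ℤ)
  · rw [hj, dilation_zero]
    simp only [zero_apply, map_zero, norm_zero]
    positivity
  rw [tailProj_dilation b hj]
  refine (norm_dilation_apply_le b _ _).trans ?_
  refine (Real.le_sqrt_of_sq_le
    (y := (((n : ℝ) / R) ^ (2 * s)) * ∑' k, norm2 k ^ (2 * s) * ‖b.repr x k‖ ^ 2) ?_).trans_eq ?_
  · refine norm_tailProj_sq_le b _ x _ _ (by positivity)
      (fun k => Real.rpow_nonneg (norm2_nonneg k) _) (fun k hk => ?_) hx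
    rw [Finset.mem_preimage, hF, norm2_smul, not_le] at hk
    rw [← Real.mul_rpow hnn (norm2_nonneg k)]
    refine Real.one_le_rpow ?_ (by positivity)
    rw [div_mul_eq_mul_div, one_le_div hR]
    exact hk.le.trans (mul_le_mul_of_nonneg_right (abs_chi_four_mul_le n) (norm2_nonneg k))
  · rw [Real.sqrt_mul (by positivity), Real.sqrt_eq_rpow (_ ^ (2 * s)), ← Real.rpow_mul hnn]
    congr 2
    ring

/-- The constant in the approximation rate. -/
noncomputable def rateConst (s : ℝ) : ℝ :=
  (∑' n : ℕ, ((n : ℝ) ^ 2)⁻¹) * ∑' n : ℕ, (n : ℝ) ^ (s - 2)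

theorem one_le_rateConst {s : ℝ} (hs : s < 1) : 1 ≤ rateConst s := by
  have h1 : (1 : ℝ) ≤ ∑' n : ℕ, ((n : ℝ) ^ 2)⁻¹ := by
    simpa using (Real.summable_nat_pow_inv.2 (by norm_num : 1 < 2)).le_tsum 1
      (fun n _ => by positivity)
  have h2 : (1 : ℝ) ≤ ∑' n : ℕ, (n : ℝ) ^ (s - 2) := by
    simpa using (Real.summable_nat_rpow.2 (by linarith : s - 2 < -1)).le_tsum 1
      (fun n _ => by positivity)
  exact one_le_mul_of_one_le_of_one_le h1 h2

theorem norm_sub_moebius_expansion_le {s R : ℝ} (hs : 0 < s) (hs1 : s < 1) (hR : 0 < R)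
    (F : Finset (Fin d → ℤ)) (hF : ∀ k, k ∈ F ↔ norm2 k ≤ R) (x : H)
    (hx : Summable fun k => norm2 k ^ (2 * s) * ‖b.repr x k‖ ^ 2) :
    ‖x - ∑ k ∈ F, b.repr (moebiusOp b x) k • zetaOp b (b k)‖ ≤
      rateConst s / R ^ s * Real.sqrt (∑' k, norm2 k ^ (2 * s) * ‖b.repr x k‖ ^ 2) := by
  set S := Real.sqrt (∑' k, norm2 k ^ (2 * s) * ‖b.repr x k‖ ^ 2) with hS
  have e : ∀ n : ℕ, ((n : ℝ) ^ 2)⁻¹ * (((n : ℝ) / R) ^ s * S) =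
      (n : ℝ) ^ (s - 2) * (S / R ^ s) := by
    intro n
    rw [Real.div_rpow (Nat.cast_nonneg n) hR.le]
    rcases eq_or_ne n 0 with rfl | hn
    -- At `n = 0` both sides vanish, by the conventions `0⁻¹ = 0` and `0 ^ (s - 2) = 0`.
    · simp [Real.zero_rpow (by linarith : s - 2 ≠ 0)]
    · rw [Real.rpow_sub (by positivity), Real.rpow_two]
      ring
  have hsum := (Real.summable_nat_rpow.2 (by linarith : s - 2 < -1))
  have ht := norm_tailProj_moebiusOp_le b F x (fun n => ((n : ℝ) / R) ^ s * S)
    (by simp only [e]; exact hsum.mul_right _)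
    (norm_tailProj_signedDilation_le b hs hR F hF x hx)
  simp only [e] at ht
  rw [tsum_mul_right] at ht
  rw [sub_sum_moebius_expansion]
  refine (ContinuousLinearMap.le_opNorm _ _).trans ?_
  refine (mul_le_mul (norm_zetaOp_le b) ht (norm_nonneg _)
    (tsum_nonneg fun n => by positivity)).trans_eq ?_
  rw [rateConst]
  ring

end Lattice

/-! ### Fourier series of the triangle waves. -/

section TriangleWaves

/-- This is the Fourier series of the Bernoulli polynomial `B₂`. -/
theorem hasSum_cos_div_sq {x : ℝ} (hx : x ∈ Set.Icc (0 : ℝ) 1) :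
    HasSum (fun n : ℕ => ((n : ℝ) ^ 2)⁻¹ * Real.cos (2 * Real.pi * n * x))
      (Real.pi ^ 2 * (x ^ 2 - x + 1 / 6)) := by
  have h := hasSum_one_div_nat_pow_mul_cos one_ne_zero hx
  have e : (Polynomial.map (algebraMap ℚ ℝ) (Polynomial.bernoulli (2 * 1))).eval x =
      x ^ 2 - x + 1 / 6 := by
    rw [mul_one, Polynomial.bernoulli]
    simp [Finset.sum_range_succ, bernoulli_one, bernoulli_two]
    ring
  rw [e] at h
  convert h using 1
  · simp
  · simp only [Nat.factorial]
    push_cast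
    ring

/-- The even terms of the `B₂` series at `x` form a quarter of the series at `2x`. Subtracting them
cancels the quadratic parts; `x ≤ 1/2` keeps `2x` in the range of validity. -/
theorem hasSum_odd_cos_of_le_half {x : ℝ} (h0 : 0 ≤ x) (h1 : x ≤ 1 / 2) :
    HasSum (fun n : ℕ => if Odd n then ((n : ℝ) ^ 2)⁻¹ * Real.cos (2 * Real.pi * n * x) else 0)
      (Real.pi ^ 2 / 8 * (1 - 4 * x)) := by
  have hF := hasSum_cos_div_sq (x := x) ⟨h0, by linarith⟩
  have hE := (hasSum_cos_div_sq (x := 2 * x) ⟨by linarith, by linarith⟩).mul_left (1 / 4 : ℝ)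
  have hinj : Function.Injective fun n : ℕ => 2 * n := fun a b h => by simpa using h
  have hE' : HasSum (fun n : ℕ => if Even n then
      ((n : ℝ) ^ 2)⁻¹ * Real.cos (2 * Real.pi * n * x) else 0)
      (1 / 4 * (Real.pi ^ 2 * ((2 * x) ^ 2 - 2 * x + 1 / 6))) := by
    rw [← hinj.hasSum_iff]
    · convert! hE using 1
      funext n
      simp only [Function.comp_apply, even_two_mul, if_true]
      push_cast
      rw [mul_pow, mul_inv]
      ring_nf
    · intro n hn
      rw [if_neg]
      rintro ⟨m, rfl⟩
      exact hn ⟨m, two_mul m⟩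
  convert! hF.sub hE' using 1
  · funext n
    rcases Nat.even_or_odd n with h | h
    · simp [h, Nat.not_odd_iff_even.2 h]
    · simp [h, Nat.not_even_iff_odd.2 h]
  · ring

theorem cos_two_pi_mul_fract (n : ℕ) (x : ℝ) :
    Real.cos (2 * Real.pi * n * Int.fract x) = Real.cos (2 * Real.pi * n * x) := by
  rw [← Real.cos_add_int_mul_two_pi _ (n * ⌊x⌋)]
  congr 1
  push_cast
  linear_combination (2 * Real.pi * n) * Int.fract_add_floor x

theorem hasSum_triCos (x : ℝ) :
    HasSum (fun n : ℕ => if Odd n then ((n : ℝ) ^ 2)⁻¹ * Real.cos (2 * Real.pi * n * x) else 0)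
      (Real.pi ^ 2 / 8 * triCos x) := by
  have h0 := Int.fract_nonneg x
  have h1 := (Int.fract_lt_one x).le
  simp only [← cos_two_pi_mul_fract _ x, triCos]
  generalize Int.fract x = y at *
  rcases le_total y (1 / 2) with h | h
  · convert hasSum_odd_cos_of_le_half h0 h using 2
    rw [abs_of_nonpos (by linarith)]
    ring
  · convert hasSum_odd_cos_of_le_half (x := 1 - y) (by linarith) (by linarith) using 2
    · congr 2
      rw [← Real.cos_nat_mul_two_pi_sub]
      congr 1
      ring
    · rw [abs_of_nonneg (by linarith)]
      ring

theorem triSin_eq_triCos (x : ℝ) : triSin x = triCos (x - 1 / 4) := by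
  have h0 := Int.fract_nonneg x
  have h1 := Int.fract_lt_one x
  have hf := Int.fract_add_floor x
  rw [triSin, triCos]
  rcases le_or_gt (1 / 4) (Int.fract x) with h | h
  · have e : Int.fract (x - 1 / 4) = Int.fract x - 1 / 4 :=
      Int.fract_eq_iff.2 ⟨by linarith, by linarith, ⌊x⌋, by linarith⟩
    rw [e, abs_of_nonneg (by linarith : 0 ≤ Int.fract x - 1 / 4)]
    rcases le_total (Int.fract x) (3 / 4) with h' | h'
    · rw [abs_of_nonneg (by linarith), abs_of_nonpos (by linarith)]
      ring
    · rw [abs_of_nonpos (by linarith), abs_of_nonneg (by linarith)]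
      ring
  · have e : Int.fract (x - 1 / 4) = Int.fract x + 3 / 4 :=
      Int.fract_eq_iff.2 ⟨by linarith, by linarith, ⌊x⌋ - 1, by push_cast; linarith⟩
    rw [e, abs_of_nonpos (by linarith : Int.fract x - 1 / 4 ≤ 0),
      abs_of_nonneg (by linarith), abs_of_nonneg (by linarith)]
    ring

theorem chi_four_sq_of_odd {n : ℕ} (hn : Odd n) :
    ZMod.χ₄ n = 1 ∨ ZMod.χ₄ n = -1 := by
  rcases Nat.odd_mod_four_iff.1 (Nat.odd_iff.1 hn) with h | h
  · exact Or.inl (ZMod.χ₄_nat_one_mod_four h)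
  · exact Or.inr (ZMod.χ₄_nat_three_mod_four h)

/-- A quarter shift changes the phase by `nπ/2`, which for odd `n` turns cosine into sine with a
sign given by `n` modulo `4`. -/
theorem cos_sub_quarter {n : ℕ} (hn : Odd n) (x : ℝ) :
    Real.cos (2 * Real.pi * n * (x - 1 / 4)) =
      ((ZMod.χ₄ n : ℤ) : ℝ) * Real.sin (2 * Real.pi * n * x) := by
  rcases Nat.odd_mod_four_iff.1 (Nat.odd_iff.1 hn) with h | h
  · rw [ZMod.χ₄_nat_one_mod_four h]
    obtain ⟨q, rfl⟩ : ∃ q, n = 4 * q + 1 := ⟨n / 4, by omega⟩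
    rw [← Real.cos_sub_pi_div_two, ← Real.cos_add_nat_mul_two_pi _ q]
    push_cast
    rw [one_mul]
    congr 1
    ring
  · rw [ZMod.χ₄_nat_three_mod_four h]
    obtain ⟨q, rfl⟩ : ∃ q, n = 4 * q + 3 := ⟨n / 4, by omega⟩
    push_cast
    rw [neg_one_mul, ← Real.cos_add_pi_div_two, ← Real.cos_add_nat_mul_two_pi _ (q + 1)]
    push_cast
    congr 1
    ring

theorem hasSum_triSin (x : ℝ) :
    HasSum (fun n : ℕ => if Odd n then ((n : ℝ) ^ 2)⁻¹ *
      (((ZMod.χ₄ n : ℤ) : ℝ) * Real.sin (2 * Real.pi * n * x)) else 0)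
      (Real.pi ^ 2 / 8 * triSin x) := by
  rw [triSin_eq_triCos]
  convert hasSum_triCos (x - 1 / 4) using 2 with n
  split_ifs with hn
  · rw [cos_sub_quarter hn]
  · rfl

/-- The complex triangle wave `𝒞 + i 𝒮`. -/
noncomputable def triExp (x : ℝ) : ℂ := ⟨triCos x, triSin x⟩

/-- The sign `χ₄(n)` in the sine series can be moved into the frequency, since sine is odd, and the
cosine series does not notice, since cosine is even. Hence both combine into exponentials of the
signed frequency `χ₄(n) n`. -/
theorem hasSum_triExp (x : ℝ) :
    HasSum (fun n : ℕ => if Odd n then ((n : ℂ) ^ 2)⁻¹ *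
      Complex.exp (2 * Real.pi * Complex.I * ((ZMod.χ₄ n * n : ℤ) * x)) else 0)
      ((Real.pi ^ 2 / 8 : ℝ) * triExp x) := by
  rw [Complex.hasSum_iff]
  constructor
  · convert hasSum_triCos x using 2 with n
    · split_ifs with hn
      · rw [show ((n : ℂ) ^ 2)⁻¹ = ((((n : ℝ) ^ 2)⁻¹ : ℝ) : ℂ) by push_cast; rfl,
          show 2 * (Real.pi : ℂ) * Complex.I * ((ZMod.χ₄ n * n : ℤ) * x) =
            ((((ZMod.χ₄ n : ℤ) : ℝ) * (2 * Real.pi * n * x) : ℝ) : ℂ) * Complex.I by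
              push_cast; ring, Complex.re_ofReal_mul, Complex.exp_ofReal_mul_I_re]
        rcases chi_four_sq_of_odd hn with h | h <;> simp [h]
      · rfl
    · rw [Complex.re_ofReal_mul, triExp]
  · convert hasSum_triSin x using 2 with n
    · split_ifs with hn
      · rw [show ((n : ℂ) ^ 2)⁻¹ = ((((n : ℝ) ^ 2)⁻¹ : ℝ) : ℂ) by push_cast; rfl,
          show 2 * (Real.pi : ℂ) * Complex.I * ((ZMod.χ₄ n * n : ℤ) * x) =
            ((((ZMod.χ₄ n : ℤ) : ℝ) * (2 * Real.pi * n * x) : ℝ) : ℂ) * Complex.I by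
              push_cast; ring, Complex.im_ofReal_mul, Complex.exp_ofReal_mul_I_im]
        rcases chi_four_sq_of_odd hn with h | h <;> simp [h]
      · rfl
    · rw [Complex.im_ofReal_mul, triExp]

theorem triCos_neg (x : ℝ) : triCos (-x) = triCos x := by
  have h : Real.pi ^ 2 / 8 ≠ 0 := by positivity
  refine mul_left_cancel₀ h ((hasSum_triCos (-x)).unique ?_)
  simpa using hasSum_triCos x

theorem triSin_neg (x : ℝ) : triSin (-x) = -triSin x := by
  have h : Real.pi ^ 2 / 8 ≠ 0 := by positivity
  refine mul_left_cancel₀ h ((hasSum_triSin (-x)).unique ?_)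
  rw [mul_neg]
  convert! (hasSum_triSin x).neg using 1
  funext n
  split_ifs <;> simp

end TriangleWaves

/-! ### The half lattice and symmetric summation. -/

section HalfLattice

variable {d : ℕ}

theorem firstPos_or_firstPos_neg {k : Fin d → ℤ} (hk : k ≠ 0) : FirstPos k ∨ FirstPos (-k) := by
  obtain ⟨i, hi⟩ := Function.ne_iff.1 hk
  obtain ⟨m, hm, hmin⟩ := WellFounded.has_min (wellFounded_lt (α := Fin d)) {i | k i ≠ 0} ⟨i, hi⟩
  have hz : ∀ j < m, k j = 0 := fun j hj => by
    by_contra h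
    exact hmin j h hj
  rcases lt_or_gt_of_ne hm with h | h
  · exact Or.inr ⟨m, by simpa using h, fun j hj => by simp [hz j hj]⟩
  · exact Or.inl ⟨m, h, hz⟩

theorem FirstPos.not_neg {k : Fin d → ℤ} (hk : FirstPos k) : ¬ FirstPos (-k) := by
  rintro ⟨j, hj, hj'⟩
  obtain ⟨i, hi, hi'⟩ := hk
  simp only [Pi.neg_apply, neg_eq_zero] at hj hj'
  rcases lt_trichotomy i j with h | h | h
  · have := hj' i h
    omega
  · subst h
    omega
  · have := hi' j h
    omega

theorem FirstPos.ne_zero {k : Fin d → ℤ} (hk : FirstPos k) : k ≠ 0 := by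
  rintro rfl
  obtain ⟨i, hi, -⟩ := hk
  simp at hi

/-- The symmetric set `{0} ∪ F ∪ -F`. -/
def symHull (F : Finset (Fin d → ℤ)) : Finset (Fin d → ℤ) := insert 0 (F ∪ F.image fun k => -k)

theorem sum_symHull {M : Type*} [AddCommMonoid M] (F : Finset (Fin d → ℤ))
    (hF : ∀ k ∈ F, FirstPos k) (u : (Fin d → ℤ) → M) :
    ∑ k ∈ symHull F, u k = u 0 + ∑ k ∈ F, (u k + u (-k)) := by
  rw [symHull, Finset.sum_insert, Finset.sum_union, Finset.sum_image fun a _ b _ h => neg_inj.1 h,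
    Finset.sum_add_distrib]
  · rw [Finset.disjoint_left]
    intro k hk hk'
    obtain ⟨m, hm, rfl⟩ := Finset.mem_image.1 hk'
    exact (hF m hm).not_neg (hF _ hk)
  · intro h
    rcases Finset.mem_union.1 h with h | h
    · exact (hF 0 h).ne_zero rfl
    · obtain ⟨m, hm, hm0⟩ := Finset.mem_image.1 h
      exact (hF m hm).ne_zero (neg_eq_zero.1 hm0)

/-- This transfers unconditional convergence over the whole lattice to finite sums over the half
lattice. -/
theorem tendsto_symHull :
    Tendsto (fun F : Finset {k : Fin d → ℤ // FirstPos k} =>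
      symHull (F.map (Function.Embedding.subtype _))) atTop atTop := by
  refine tendsto_atTop_finset_of_monotone (fun F G h => ?_) fun k => ?_
  · have h' := Finset.map_subset_map (f := Function.Embedding.subtype FirstPos).2 h
    exact Finset.insert_subset_insert _
      (Finset.union_subset_union h' (Finset.image_subset_image h'))
  · by_cases hk : k = 0
    · exact ⟨∅, by simp [symHull, hk]⟩
    · rcases firstPos_or_firstPos_neg hk with h | h
      · exact ⟨{⟨k, h⟩}, by simp [symHull]⟩
      · exact ⟨{⟨-k, h⟩}, by simp [symHull]⟩

theorem norm2_neg (k : Fin d → ℤ) : norm2 (-k) = norm2 k := by simp [norm2]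

theorem mem_posBall {R : ℝ} {k : Fin d → ℤ} : k ∈ posBall R d ↔ norm2 k ≤ R ∧ FirstPos k := by
  simp [posBall, latticeBall]

theorem mem_symHull_posBall {R : ℝ} (hR : 0 ≤ R) (k : Fin d → ℤ) :
    k ∈ symHull (posBall R d) ↔ norm2 k ≤ R := by
  simp only [symHull, Finset.mem_insert, Finset.mem_union, Finset.mem_image, mem_posBall]
  constructor
  · rintro (rfl | h | ⟨m, hm, rfl⟩)
    · rwa [norm2_zero]
    · exact h.1
    · rw [norm2_neg]
      exact hm.1
  · intro h
    by_cases hk : k = 0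
    · exact Or.inl hk
    · rcases firstPos_or_firstPos_neg hk with hp | hp
      · exact Or.inr (Or.inl ⟨h, hp⟩)
      · exact Or.inr (Or.inr ⟨-k, ⟨by rwa [norm2_neg], hp⟩, neg_neg k⟩)

theorem dotZ_neg (k : Fin d → ℤ) (x : Fin d → ℝ) : dotZ (-k) x = -dotZ k x := by
  simp [dotZ]

theorem measurable_triCos : Measurable triCos := by
  unfold triCos
  have := measurable_fract (R := ℝ)
  fun_prop

theorem measurable_triSin : Measurable triSin := by
  rw [funext triSin_eq_triCos]
  exact measurable_triCos.comp (measurable_id.sub_const _)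

theorem measurable_dotZ (k : Fin d → ℤ) : Measurable (dotZ k) := by
  unfold dotZ
  fun_prop

end HalfLattice

/-! ### Transfer between the cube and the torus. -/

section Torus

noncomputable local instance : MeasureSpace UnitAddCircle := ⟨AddCircle.haarAddCircle⟩

local instance : IsProbabilityMeasure (volume : Measure UnitAddCircle) :=
  inferInstanceAs (IsProbabilityMeasure AddCircle.haarAddCircle)

variable {d : ℕ}

/-- The representative of a point of the torus in `(0, 1]^d`. -/
noncomputable def torusLift (t : UnitAddTorus (Fin d)) : Fin d → ℝ :=
  (UnitAddTorus.measurableEquivPiIoc (0 : Fin d → ℝ) t).1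

theorem coe_torusLift (t : UnitAddTorus (Fin d)) (i : Fin d) :
    ((torusLift t i : ℝ) : UnitAddCircle) = t i :=
  congrFun ((UnitAddTorus.measurableEquivPiIoc (0 : Fin d → ℝ)).symm_apply_apply t) i

theorem measurePreserving_torusLift :
    MeasurePreserving (torusLift (d := d)) volume (volume.restrict (cube d)) := by
  have h1 := UnitAddTorus.measurePreserving_equivPiIoc (0 : Fin d → ℝ)
  have h2 : MeasurePreserving Subtype.val
      (Measure.comap (Subtype.val : {x : Fin d → ℝ // ∀ i, x i ∈ Set.Ioc ((0 : Fin d → ℝ) i)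
        ((0 : Fin d → ℝ) i + 1)} → _) volume)
      (volume.restrict {x : Fin d → ℝ | ∀ i, x i ∈ Set.Ioc ((0 : Fin d → ℝ) i)
        ((0 : Fin d → ℝ) i + 1)}) :=
    measurePreserving_subtype_coe (MeasurableSet.univ_pi' fun i => measurableSet_Ioc)
  have h3 : volume.restrict {x : Fin d → ℝ | ∀ i, x i ∈ Set.Ioc ((0 : Fin d → ℝ) i)
      ((0 : Fin d → ℝ) i + 1)} = volume.restrict (cube d) := by
    refine Measure.restrict_congr_set ?_
    have h := Measure.univ_pi_Ioc_ae_eq_Icc (μ := fun _ : Fin d => (volume : Measure ℝ))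
      (f := 0) (g := 1)
    have e : {x : Fin d → ℝ | ∀ i, x i ∈ Set.Ioc ((0 : Fin d → ℝ) i)
        ((0 : Fin d → ℝ) i + 1)} = Set.univ.pi fun i => Set.Ioc ((0 : Fin d → ℝ) i) (1 : ℝ) := by
      ext x
      simp
    rw [e]
    exact h
  rw [← h3]
  exact h2.comp h1

theorem mFourier_torusLift (m : Fin d → ℤ) (t : UnitAddTorus (Fin d)) :
    UnitAddTorus.mFourier m t =
      Complex.exp (2 * Real.pi * Complex.I * (dotZ m (torusLift t) : ℂ)) := by
  simp only [UnitAddTorus.mFourier, ContinuousMap.coe_mk]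
  rw [Finset.prod_congr rfl fun i _ => by rw [← coe_torusLift t i, fourier_coe_apply],
    ← Complex.exp_sum]
  congr 1
  rw [dotZ]
  push_cast
  rw [Finset.mul_sum]
  exact Finset.sum_congr rfl fun i _ => by ring

theorem mFourierCoeff_comp_torusLift (f : (Fin d → ℝ) → ℝ)
    (hf : MemLp f 2 (volume.restrict (cube d))) (m : Fin d → ℤ) :
    UnitAddTorus.mFourierCoeff (fun t => (f (torusLift t) : ℂ)) m = fourierCoef f m := by
  rw [fourierCoef, ← measurePreserving_torusLift.map_eq, integral_map, UnitAddTorus.mFourierCoeff]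
  · refine integral_congr_ae (Eventually.of_forall fun t => ?_)
    simp only [mFourier_torusLift, smul_eq_mul]
    rw [mul_comm]
    congr 2
    simp [dotZ]
  · exact measurePreserving_torusLift.measurable.aemeasurable
  · rw [measurePreserving_torusLift.map_eq]
    refine (Complex.continuous_ofReal.comp_aestronglyMeasurable hf.1).mul ?_
    refine Continuous.aestronglyMeasurable ?_
    unfold dotZ
    fun_prop

/-- The element of `L²` of the torus given by a function on the cube. -/
noncomputable def toTorus (f : (Fin d → ℝ) → ℝ) (hf : MemLp f 2 (volume.restrict (cube d))) :
    Lp ℂ 2 (volume : Measure (UnitAddTorus (Fin d))) :=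
  ((hf.comp_measurePreserving measurePreserving_torusLift).ofReal (K := ℂ)).toLp _

theorem repr_toTorus (f : (Fin d → ℝ) → ℝ) (hf : MemLp f 2 (volume.restrict (cube d)))
    (m : Fin d → ℤ) :
    UnitAddTorus.mFourierBasis.repr (toTorus f hf) m = fourierCoef f m := by
  rw [UnitAddTorus.mFourierBasis_repr, ← mFourierCoeff_comp_torusLift f hf]
  refine integral_congr_ae ?_
  filter_upwards [MemLp.coeFn_toLp
    ((hf.comp_measurePreserving measurePreserving_torusLift).ofReal (K := ℂ))] with t ht
  rw [toTorus, ht]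
  rfl

theorem signedDilation_mFourierBasis (n : ℕ) (k : Fin d → ℤ) :
    signedDilation (UnitAddTorus.mFourierBasis (d := Fin d)) n (UnitAddTorus.mFourierBasis k) =
      if Odd n then UnitAddTorus.mFourierBasis ((ZMod.χ₄ n * n : ℤ) • k) else 0 := by
  change dilation _ (ZMod.χ₄ n * n) _ = _
  split_ifs with hn
  · refine dilation_basis _ ?_ k
    have : (n : ℤ) ≠ 0 := by exact_mod_cast hn.pos.ne'
    rcases chi_four_sq_of_odd hn with h | h <;> simp [h, hn.pos.ne']
  · have : ZMod.χ₄ (n : ZMod 4) = 0 := by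
      rw [ZMod.χ₄_nat_eq_if_mod_four, if_pos (Nat.even_iff.1 (Nat.not_odd_iff_even.1 hn))]
    rw [this, zero_mul, dilation_zero]
    simp

/-- The series converges uniformly, so its `L²` limit and its pointwise limit come from one
continuous function `F`. -/
theorem zetaOp_mFourierBasis (k : Fin d → ℤ) :
    (zetaOp (UnitAddTorus.mFourierBasis (d := Fin d)) (UnitAddTorus.mFourierBasis k) :
      UnitAddTorus (Fin d) → ℂ) =ᵐ[volume]
      fun t => (Real.pi ^ 2 / 8 : ℝ) * triExp (dotZ k (torusLift t)) := by
  have hc : Summable fun n : ℕ => if Odd n then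
      ((n : ℂ) ^ 2)⁻¹ • UnitAddTorus.mFourier ((ZMod.χ₄ n * n : ℤ) • k) else 0 := by
    refine Summable.of_norm_bounded (g := fun n : ℕ => ((n : ℝ) ^ 2)⁻¹)
      (Real.summable_nat_pow_inv.2 (by norm_num : 1 < 2)) fun n => ?_
    split_ifs
    · rw [norm_smul, UnitAddTorus.mFourier_norm, norm_inv, norm_pow, Complex.norm_natCast, mul_one]
    · rw [norm_zero]
      positivity
  obtain ⟨F, hF⟩ := hc
  have h1 := hF.mapL (ContinuousMap.toLp (E := ℂ) 2 (volume : Measure (UnitAddTorus (Fin d))) ℂ)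
  have h2 := hasSum_zetaOp_basis (UnitAddTorus.mFourierBasis (d := Fin d)) k
  have h3 : zetaOp (UnitAddTorus.mFourierBasis (d := Fin d)) (UnitAddTorus.mFourierBasis k) =
      ContinuousMap.toLp (E := ℂ) 2 (volume : Measure (UnitAddTorus (Fin d))) ℂ F := by
    refine h2.unique ?_
    convert h1 using 2 with n
    rw [signedDilation_mFourierBasis, UnitAddTorus.coe_mFourierBasis]
    split_ifs <;> simp
  rw [h3]
  filter_upwards [ContinuousMap.coeFn_toLp (p := 2) (𝕜 := ℂ) volume F] with t ht
  rw [ht]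
  have h4 := hF.mapL (ContinuousMap.evalCLM ℂ t)
  refine h4.unique ?_
  convert hasSum_triExp (dotZ k (torusLift t)) using 2 with n
  split_ifs
  · simp only [map_smul, smul_eq_mul, ContinuousMap.evalCLM_apply, mFourier_torusLift]
    congr 4
    simp [dotZ, Finset.mul_sum, mul_assoc]
  · simp

variable (f : (Fin d → ℝ) → ℝ) (hf : MemLp f 2 (volume.restrict (cube d)))

/-- The coefficients of `f` with respect to the complex triangle waves. -/
noncomputable def triCoef (k : Fin d → ℤ) : ℂ :=
  (Real.pi ^ 2 / 8 : ℝ) *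
    UnitAddTorus.mFourierBasis.repr (moebiusOp UnitAddTorus.mFourierBasis (toTorus f hf)) k

/-- The constant coefficient of the triangle wave expansion. -/
noncomputable def triCoefConst : ℝ := (triCoef f hf 0).re

/-- The coefficients of `𝒞(k · x)` in the triangle wave expansion. -/
noncomputable def triCoefCos (k : Fin d → ℤ) : ℝ := (triCoef f hf k).re + (triCoef f hf (-k)).re

/-- The coefficients of `𝒮(k · x)` in the triangle wave expansion. -/
noncomputable def triCoefSin (k : Fin d → ℤ) : ℝ := (triCoef f hf (-k)).im - (triCoef f hf k).im

/-- The remainder of the expansion of `toTorus f hf` after summation over `F`. -/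
noncomputable def triRemainder (F : Finset (Fin d → ℤ)) :
    Lp ℂ 2 (volume : Measure (UnitAddTorus (Fin d))) :=
  toTorus f hf - ∑ k ∈ F,
    UnitAddTorus.mFourierBasis.repr (moebiusOp UnitAddTorus.mFourierBasis (toTorus f hf)) k •
      zetaOp UnitAddTorus.mFourierBasis (UnitAddTorus.mFourierBasis k)

theorem re_sum_symHull (F : Finset (Fin d → ℤ)) (hF : ∀ k ∈ F, FirstPos k) (x : Fin d → ℝ) :
    (∑ k ∈ symHull F, triCoef f hf k * triExp (dotZ k x)).re =
      triCoefConst f hf + ∑ k ∈ F, (triCoefCos f hf k * triCos (dotZ k x) +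
        triCoefSin f hf k * triSin (dotZ k x)) := by
  rw [sum_symHull F hF, Complex.add_re, Complex.re_sum]
  congr 1
  · simp [triCoefConst, triExp, dotZ, triCos, triSin]
    norm_num
  · refine Finset.sum_congr rfl fun k _ => ?_
    simp only [Complex.add_re, Complex.mul_re, triExp, dotZ_neg, triCos_neg, triSin_neg,
      triCoefCos, triCoefSin]
    ring

/-- As `f` is real, passing to the real part of the complex sum can only decrease the pointwise
error. -/
theorem l2Norm_sub_re_sum_le (F : Finset (Fin d → ℤ)) :
    l2Norm (fun x => f x - (∑ k ∈ F, triCoef f hf k * triExp (dotZ k x)).re) ≤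
      ENNReal.ofReal ‖triRemainder f hf F‖ := by
  have hm : AEStronglyMeasurable
      (fun x => f x - (∑ k ∈ F, triCoef f hf k * triExp (dotZ k x)).re)
      (volume.restrict (cube d)) := by
    refine hf.1.sub (Measurable.aestronglyMeasurable ?_)
    simp only [Complex.re_sum, Complex.mul_re, triExp]
    have h1 := fun k : Fin d → ℤ => measurable_triCos.comp (measurable_dotZ k)
    have h2 := fun k : Fin d → ℤ => measurable_triSin.comp (measurable_dotZ k)
    exact Finset.measurable_sum _ fun k _ => ((h1 k).const_mul _).sub ((h2 k).const_mul _)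
  rw [l2Norm, ← eLpNorm_comp_measurePreserving hm measurePreserving_torusLift,
    ofReal_norm, Lp.enorm_def]
  refine eLpNorm_mono_ae ?_
  have h1 : ∀ᵐ t, ∀ k ∈ F, (UnitAddTorus.mFourierBasis.repr
      (moebiusOp UnitAddTorus.mFourierBasis (toTorus f hf)) k •
      zetaOp UnitAddTorus.mFourierBasis (UnitAddTorus.mFourierBasis k) :
        Lp ℂ 2 (volume : Measure (UnitAddTorus (Fin d)))) t =
      triCoef f hf k * triExp (dotZ k (torusLift t)) := by
    rw [Filter.eventually_all_finset]
    intro k _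
    filter_upwards [zetaOp_mFourierBasis k, Lp.coeFn_smul (UnitAddTorus.mFourierBasis.repr
      (moebiusOp UnitAddTorus.mFourierBasis (toTorus f hf)) k)
      (zetaOp UnitAddTorus.mFourierBasis (UnitAddTorus.mFourierBasis k))] with t h h'
    rw [h', Pi.smul_apply, h, triCoef, smul_eq_mul]
    ring
  filter_upwards [h1, Lp.coeFn_sub (toTorus f hf) (∑ k ∈ F,
    UnitAddTorus.mFourierBasis.repr (moebiusOp UnitAddTorus.mFourierBasis (toTorus f hf)) k •
      zetaOp UnitAddTorus.mFourierBasis (UnitAddTorus.mFourierBasis k)),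
    Lp.coeFn_finsetSum F fun k =>
    UnitAddTorus.mFourierBasis.repr (moebiusOp UnitAddTorus.mFourierBasis (toTorus f hf)) k •
      zetaOp UnitAddTorus.mFourierBasis (UnitAddTorus.mFourierBasis k),
    MemLp.coeFn_toLp ((hf.comp_measurePreserving measurePreserving_torusLift).ofReal (K := ℂ))]
    with t h1 h2 h3 h4
  rw [triRemainder, h2, Pi.sub_apply, h3, Finset.sum_apply, Finset.sum_congr rfl h1, toTorus, h4,
    Function.comp_apply]
  refine le_trans (le_of_eq ?_) (Complex.abs_re_le_norm _)
  simp

theorem hasTriExpansion_triCoef :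
    HasTriExpansion f (triCoefConst f hf) (triCoefCos f hf) (triCoefSin f hf) := by
  have h := hasSum_moebius_expansion UnitAddTorus.mFourierBasis (toTorus f hf)
  have h1 : Tendsto (fun F => ENNReal.ofReal ‖triRemainder f hf F‖) atTop (𝓝 0) := by
    have h2 := ENNReal.tendsto_ofReal ((tendsto_const_nhds (x := toTorus f hf)).sub h).norm
    rwa [sub_self, norm_zero, ENNReal.ofReal_zero] at h2
  refine tendsto_of_tendsto_of_tendsto_of_le_of_le tendsto_const_nhds
    (h1.comp tendsto_symHull) (fun _ => bot_le) fun F => ?_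
  have h3 := l2Norm_sub_re_sum_le f hf (symHull (F.map (Function.Embedding.subtype _)))
  have hF : ∀ k ∈ F.map (Function.Embedding.subtype FirstPos), FirstPos k := by
    intro k hk
    obtain ⟨a, -, rfl⟩ := Finset.mem_map.1 hk
    exact a.2
  simp only [re_sum_symHull f hf _ hF, Finset.sum_map, Function.Embedding.subtype_apply] at h3
  exact h3

/-- The weight at `k = 0` is `0 ^ (2 * s) = 0`, so the sum extends to the whole lattice at no cost,
and the term `|a₀|²` is discarded. -/
theorem MemSobolev.summable_and_tsum_le {s : ℝ} (hs : 0 < s) (h : MemSobolev s f) :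
    (Summable fun k => norm2 k ^ (2 * s) * ‖fourierCoef f k‖ ^ 2) ∧
      Real.sqrt (∑' k, norm2 k ^ (2 * s) * ‖fourierCoef f k‖ ^ 2) ≤ sobolevNorm s f := by
  have hsup : Function.support (fun k : Fin d → ℤ => norm2 k ^ (2 * s) * ‖fourierCoef f k‖ ^ 2) ⊆
      {m | m ≠ 0} := by
    rintro k hk rfl
    simp [norm2_zero, Real.zero_rpow (by positivity : 2 * s ≠ 0)] at hk
  have h1 := (hasSum_subtype_iff_of_support_subset hsup).1 h.summable.hasSum
  refine ⟨h1.summable, Real.sqrt_le_sqrt ?_⟩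
  rw [h1.tsum_eq]
  exact le_add_of_nonneg_left (by positivity)

theorem l2Norm_sub_partialSum_le {s R : ℝ} (hs : 0 < s) (hs1 : s < 1) (hR : 0 < R)
    (h : MemSobolev s f) :
    l2Norm (fun x => f x - partialSum (truncate R (triCoefConst f h.memLp) (triCoefCos f h.memLp)
      (triCoefSin f h.memLp)) x) ≤ ENNReal.ofReal (rateConst s / R ^ s * sobolevNorm s f) := by
  have h1 := l2Norm_sub_re_sum_le f h.memLp (symHull (posBall R d))
  simp only [re_sum_symHull f h.memLp _ fun k hk => (mem_posBall.1 hk).2] at h1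
  have h2 : ∀ x, partialSum (truncate R (triCoefConst f h.memLp) (triCoefCos f h.memLp)
      (triCoefSin f h.memLp)) x = triCoefConst f h.memLp + ∑ k ∈ posBall R d,
        (triCoefCos f h.memLp k * triCos (dotZ k x) +
          triCoefSin f h.memLp k * triSin (dotZ k x)) := by
    intro x
    rw [partialSum, truncate, ← Finset.sum_coe_sort (posBall R d)]
  simp only [h2]
  refine h1.trans (ENNReal.ofReal_le_ofReal ?_)
  obtain ⟨h3, h4⟩ := h.summable_and_tsum_le f hs
  have h5 := norm_sub_moebius_expansion_le UnitAddTorus.mFourierBasis hs hs1 hR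
    (symHull (posBall R d)) (mem_symHull_posBall hR.le) (toTorus f h.memLp)
    (by simpa only [repr_toTorus] using h3)
  simp only [repr_toTorus f h.memLp] at h5
  refine h5.trans (mul_le_mul_of_nonneg_left h4 ?_)
  have := one_le_rateConst hs1
  positivity

end Torus

/-! ### The ReLU network for the partial sums. -/

section Network

theorem triCos_add_int (x : ℝ) (n : ℤ) : triCos (x + n) = triCos x := by
  simp [triCos]

/-- The distance to the nearest integer. -/
noncomputable def distZ (x : ℝ) : ℝ := (1 - triCos x) / 4

theorem distZ_nonneg (x : ℝ) : 0 ≤ distZ x := by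
  have h : |Int.fract x - 1 / 2| ≤ 1 / 2 :=
    abs_le.2 ⟨by linarith [Int.fract_nonneg x], by linarith [Int.fract_lt_one x]⟩
  rw [distZ, triCos]
  linarith

theorem distZ_le_half (x : ℝ) : distZ x ≤ 1 / 2 := by
  rw [distZ, triCos]
  linarith [abs_nonneg (Int.fract x - 1 / 2)]

theorem distZ_neg (x : ℝ) : distZ (-x) = distZ x := by rw [distZ, triCos_neg, distZ]

theorem distZ_add_int (x : ℝ) (n : ℤ) : distZ (x + n) = distZ x := by
  rw [distZ, triCos_add_int, distZ]

theorem distZ_of_le_half {x : ℝ} (h0 : 0 ≤ x) (h1 : x ≤ 1 / 2) : distZ x = x := by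
  rw [distZ, triCos, Int.fract_eq_self.2 ⟨h0, by linarith⟩, abs_of_nonpos (by linarith)]
  ring

theorem distZ_of_half_le {x : ℝ} (h0 : 1 / 2 ≤ x) (h1 : x ≤ 1) : distZ x = 1 - x := by
  rw [← distZ_of_le_half (x := 1 - x) (by linarith) (by linarith), ← distZ_neg x,
    ← distZ_add_int (-x) 1]
  congr 1
  push_cast
  ring

/-- Modulo integers `distZ x` is `x` or `-x`, and `distZ` is even and periodic. -/
theorem distZ_four_mul_distZ (x : ℝ) : distZ (4 * distZ x) = distZ (4 * x) := by
  have e : distZ (4 * Int.fract x) = distZ (4 * x) := by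
    rw [← distZ_add_int (4 * Int.fract x) (4 * ⌊x⌋)]
    congr 1
    push_cast
    linarith [Int.fract_add_floor x]
  have e' : distZ x = distZ (Int.fract x) := by
    rw [← distZ_add_int (Int.fract x) ⌊x⌋, Int.fract_add_floor]
  rw [← e, e']
  have h0 := Int.fract_nonneg x
  have h1 := (Int.fract_lt_one x).le
  rcases le_total (Int.fract x) (1 / 2) with h | h
  · rw [distZ_of_le_half h0 h]
  · rw [distZ_of_half_le h h1, ← distZ_neg, ← distZ_add_int _ 4]
    congr 1
    push_cast
    ring

/-- The coefficients of the four-piece zigzag function as a combination of ReLU functions. -/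
noncomputable def foldCoef : Fin 4 → ℝ := ![4, -8, 8, -8]

/-- The zigzag has slopes `4, -4, 4, -4` with breakpoints at multiples of `1/8`; `foldCoef` lists
the initial slope and the jumps. -/
theorem sum_foldCoef_mul_max {y : ℝ} (h0 : 0 ≤ y) (h1 : y ≤ 1 / 2) :
    ∑ i : Fin 4, foldCoef i * max (y - (i : ℕ) / 8) 0 = distZ (4 * y) := by
  have e : distZ (4 * y) = distZ (4 * y - 1) := by
    rw [← distZ_add_int (4 * y - 1) 1]
    congr 1
    push_cast
    ring
  simp only [foldCoef, Fin.sum_univ_four, Matrix.cons_val]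
  norm_num
  rw [max_eq_left h0]
  rcases le_total y (1 / 8) with h | h
  · rw [max_eq_right (by linarith), max_eq_right (by linarith), max_eq_right (by linarith),
      distZ_of_le_half (by linarith) (by linarith)]
    ring
  rcases le_total y (1 / 4) with h' | h'
  · rw [max_eq_left (by linarith), max_eq_right (by linarith), max_eq_right (by linarith),
      distZ_of_half_le (by linarith) (by linarith)]
    ring
  rcases le_total y (3 / 8) with h'' | h''
  · rw [max_eq_left (by linarith), max_eq_left (by linarith), max_eq_right (by linarith), e,
      distZ_of_le_half (by linarith) (by linarith)]
    ring
  · rw [max_eq_left (by linarith), max_eq_left (by linarith), max_eq_left (by linarith), e,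
      distZ_of_half_le (by linarith) (by linarith)]
    ring

variable {R : ℝ} {d : ℕ}

theorem exists_equiv_latticeBall (R : ℝ) (d : ℕ) :
    Nonempty (Fin (4 * latticeCount R d) ≃ latticeBall R d × Fin 4) := by
  have : Finite (latticeBall R d) := latticeBall_finite R d
  refine ⟨(Finite.equivFinOfCardEq ?_).symm⟩
  rw [Nat.card_prod, Nat.card_fin, mul_comm]
  rfl

/-- A labelling of the neurons of a layer by the lattice points of the ball and four slots. -/
noncomputable def neuronEquiv (R : ℝ) (d : ℕ) :
    Fin (4 * latticeCount R d) ≃ latticeBall R d × Fin 4 :=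
  (exists_equiv_latticeBall R d).some

open Classical in
/-- The phase that turns `𝒞` into `𝒮` on the negative half of the lattice. -/
noncomputable def phase (k : Fin d → ℤ) : ℝ := if FirstPos k then 0 else 1 / 4

/-- The hidden layers that compute `distZ (k · x - phase k)` for all `k` in the ball. -/
noncomputable def waveLayers (R : ℝ) (d m : ℕ) :
    HiddenLayers d (4 * latticeCount R d) (m + 1) where
  inWeight a i := ((neuronEquiv R d a).1.1 i : ℝ) / 4 ^ (m + 1)
  inBias a := (4 ^ m - phase (neuronEquiv R d a).1.1) / 4 ^ (m + 1) -
    ((neuronEquiv R d a).2 : ℕ) / 8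
  midWeight _ a b :=
    ∑ i, if b = (neuronEquiv R d).symm ((neuronEquiv R d a).1, i) then foldCoef i else 0
  midBias _ a := -(((neuronEquiv R d a).2 : ℕ) / 8)

/-- The scaled input of the group of neurons belonging to `k`. -/
noncomputable def waveInput (m : ℕ) (k : Fin d → ℤ) (x : Fin d → ℝ) : ℝ :=
  (dotZ k x + (4 ^ m - phase k)) / 4 ^ (m + 1)

/-- Integers satisfy `|k i| ≤ k i ^ 2`, so the bound is free of `d`. -/
theorem abs_dotZ_le (k : Fin d → ℤ) {x : Fin d → ℝ} (hx : x ∈ cube d) :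
    |dotZ k x| ≤ norm2 k ^ 2 := by
  rw [norm2, Real.sq_sqrt (Finset.sum_nonneg fun i _ => sq_nonneg _), dotZ]
  refine (Finset.abs_sum_le_sum_abs _ _).trans (Finset.sum_le_sum fun i _ => ?_)
  have h0 : 0 ≤ x i := hx.1 i
  have h1 : x i ≤ 1 := hx.2 i
  rw [abs_mul, abs_of_nonneg h0]
  refine (mul_le_of_le_one_right (abs_nonneg _) h1).trans ?_
  have : |k i| ≤ k i ^ 2 := by
    rw [← Int.natCast_natAbs, ← Int.natAbs_sq]
    exact_mod_cast Nat.le_self_pow two_ne_zero _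
  exact_mod_cast this

theorem waveInput_mem {m : ℕ} (hm : R ^ 2 + 1 / 4 ≤ 4 ^ m) {k : Fin d → ℤ}
    (hk : k ∈ latticeBall R d) {x : Fin d → ℝ} (hx : x ∈ cube d) :
    0 ≤ waveInput m k x ∧ waveInput m k x ≤ 1 / 2 := by
  have h1 := abs_le.1 (abs_dotZ_le k hx)
  have h2 : norm2 k ^ 2 ≤ R ^ 2 := pow_le_pow_left₀ (norm2_nonneg k) hk 2
  have h3 : 0 ≤ phase k ∧ phase k ≤ 1 / 4 := by
    rw [phase]
    split_ifs <;> norm_num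
  have h4 : (0 : ℝ) < 4 ^ (m + 1) := by positivity
  rw [waveInput, le_div_iff₀ h4, div_le_iff₀ h4, pow_succ]
  constructor <;> linarith

/-- Recombining four ReLUs into the zigzag and subtracting the next offsets `i/8` are both affine,
so a single hidden layer performs one fold. -/
theorem sum_foldCoef_layer (m : ℕ) (y : latticeBall R d → ℝ)
    (hy : ∀ k, 0 ≤ y k ∧ y k ≤ 1 / 2) (j : Fin m) :
    relu (((waveLayers R d m).midWeight j).mulVec (fun a =>
        max (y (neuronEquiv R d a).1 - ((neuronEquiv R d a).2 : ℕ) / 8) 0) +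
      (waveLayers R d m).midBias j) = fun a =>
        max (distZ (4 * y (neuronEquiv R d a).1) - ((neuronEquiv R d a).2 : ℕ) / 8) 0 := by
  funext a
  rw [← sum_foldCoef_mul_max (hy _).1 (hy _).2]
  simp only [relu, Pi.add_apply, Matrix.mulVec, dotProduct, waveLayers]
  congr 1
  rw [sub_eq_add_neg]
  congr 1
  simp only [Finset.sum_mul]
  rw [Finset.sum_comm]
  refine Finset.sum_congr rfl fun i _ => ?_
  simp [ite_mul]

theorem eval_waveLayers {m : ℕ} (hm : R ^ 2 + 1 / 4 ≤ 4 ^ m) {x : Fin d → ℝ} (hx : x ∈ cube d) :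
    (waveLayers R d m).eval x = fun a =>
      max (distZ (4 ^ m * waveInput m (neuronEquiv R d a).1.1 x) -
        ((neuronEquiv R d a).2 : ℕ) / 8) 0 := by
  have h0 : relu ((waveLayers R d m).inWeight.mulVec x + (waveLayers R d m).inBias) = fun a =>
      max (distZ (4 ^ 0 * waveInput m (neuronEquiv R d a).1.1 x) -
        ((neuronEquiv R d a).2 : ℕ) / 8) 0 := by
    funext a
    obtain ⟨h1, h2⟩ := waveInput_mem hm (neuronEquiv R d a).1.2 hx
    rw [pow_zero, one_mul, distZ_of_le_half h1 h2]
    simp only [relu, Pi.add_apply, Matrix.mulVec, dotProduct, waveLayers, waveInput, dotZ]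
    rw [add_div, Finset.sum_div, add_sub_assoc]
    congr 2
    exact Finset.sum_congr rfl fun i _ => by ring
  -- The reindexing `g` allows induction on the number of layers traversed while the network itself
  -- stays fixed.
  have h : ∀ n ≤ m, ∀ g : Fin n → Fin m, Fin.foldl n (fun v j =>
      relu (((waveLayers R d m).midWeight (g j)).mulVec v + (waveLayers R d m).midBias (g j)))
      (relu ((waveLayers R d m).inWeight.mulVec x + (waveLayers R d m).inBias)) = fun a =>
      max (distZ (4 ^ n * waveInput m (neuronEquiv R d a).1.1 x) -
        ((neuronEquiv R d a).2 : ℕ) / 8) 0 := by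
    intro n hn
    induction n with
    | zero => intro g; rw [Fin.foldl_zero, h0]
    | succ n ih =>
      intro g
      rw [Fin.foldl_succ_last, ih (by omega) fun j => g j.castSucc,
        sum_foldCoef_layer m (fun k => distZ (4 ^ n * waveInput m k.1 x))
          fun k => ⟨distZ_nonneg _, distZ_le_half _⟩]
      funext a
      rw [distZ_four_mul_distZ, pow_succ', mul_assoc]
  exact h m le_rfl id

/-- The output map performs one more fold, so the total factor is `4 ^ (m + 1)`, which cancels the
scaling of the input. The shift by `4 ^ m`, which made the input nonnegative, is an integer and
disappears. -/
theorem sum_foldCoef_eval {m : ℕ} (hm : R ^ 2 + 1 / 4 ≤ 4 ^ m) {x : Fin d → ℝ} (hx : x ∈ cube d)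
    (k : latticeBall R d) :
    ∑ i, foldCoef i * (waveLayers R d m).eval x ((neuronEquiv R d).symm (k, i)) =
      (1 - triCos (dotZ k.1 x - phase k.1)) / 4 := by
  simp only [eval_waveLayers hm hx, Equiv.apply_symm_apply]
  rw [sum_foldCoef_mul_max (distZ_nonneg _) (distZ_le_half _), distZ_four_mul_distZ, ← mul_assoc,
    ← pow_succ', waveInput, mul_div_cancel₀ _ (by positivity), ← distZ,
    ← distZ_add_int (dotZ k.1 x - phase k.1) (4 ^ m)]
  congr 1
  push_cast
  ring

theorem mem_latticeBall_of_posBall (q : posBall R d) : q.1 ∈ latticeBall R d :=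
  (mem_posBall.1 q.2).1

theorem neg_mem_latticeBall_of_posBall (q : posBall R d) : -q.1 ∈ latticeBall R d := by
  change norm2 (-q.1) ≤ R
  rw [norm2_neg]
  exact (mem_posBall.1 q.2).1

open Classical in
/-- The network that computes the partial sum with coefficients `c`. -/
noncomputable def waveNetwork (R : ℝ) (d m : ℕ) (c : TriCoeffs R d) :
    ReLUNetwork d (4 * latticeCount R d) (m + 1) where
  toHiddenLayers := waveLayers R d m
  outWeight a := ∑ q : posBall R d, ∑ i,
    ((if a = (neuronEquiv R d).symm (⟨-q.1, neg_mem_latticeBall_of_posBall q⟩, i) then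
      4 * foldCoef i else 0) * c.2.2 q -
    (if a = (neuronEquiv R d).symm (⟨q.1, mem_latticeBall_of_posBall q⟩, i) then
      4 * foldCoef i else 0) * c.2.1 q)
  outBias := c.1 + ∑ q : posBall R d, (c.2.1 q - c.2.2 q)

theorem isLinearMap_waveNetwork (R : ℝ) (d m : ℕ) :
    IsLinearMap ℝ fun c => ((waveNetwork R d m c).outWeight, (waveNetwork R d m c).outBias) where
  map_add c c' := by
    refine Prod.ext (funext fun a => ?_) ?_
    · simp only [waveNetwork, Prod.fst_add, Prod.snd_add, Pi.add_apply, ← Finset.sum_add_distrib]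
      exact Finset.sum_congr rfl fun q _ => Finset.sum_congr rfl fun i _ => by ring
    · simp only [waveNetwork, Prod.fst_add, Prod.snd_add, Pi.add_apply]
      rw [add_add_add_comm, ← Finset.sum_add_distrib]
      congr 1
      exact Finset.sum_congr rfl fun q _ => by ring
  map_smul r c := by
    refine Prod.ext (funext fun a => ?_) ?_
    · simp only [waveNetwork, Prod.smul_fst, Prod.smul_snd, Pi.smul_apply, smul_eq_mul,
        Finset.mul_sum]
      exact Finset.sum_congr rfl fun q _ => Finset.sum_congr rfl fun i _ => by ring
    · simp only [waveNetwork, Prod.smul_fst, Prod.smul_snd, Pi.smul_apply, smul_eq_mul, mul_add,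
        Finset.mul_sum, mul_sub]

theorem eval_waveNetwork {m : ℕ} (hm : R ^ 2 + 1 / 4 ≤ 4 ^ m) (c : TriCoeffs R d)
    {x : Fin d → ℝ} (hx : x ∈ cube d) : (waveNetwork R d m c).eval x = partialSum c x := by
  have h : ∀ q : posBall R d, ∑ a, (∑ i,
      ((if a = (neuronEquiv R d).symm (⟨-q.1, neg_mem_latticeBall_of_posBall q⟩, i) then
        4 * foldCoef i else 0) * c.2.2 q -
      (if a = (neuronEquiv R d).symm (⟨q.1, mem_latticeBall_of_posBall q⟩, i) then
        4 * foldCoef i else 0) * c.2.1 q)) * (waveLayers R d m).eval x a =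
      c.2.1 q * triCos (dotZ q.1 x) + c.2.2 q * triSin (dotZ q.1 x) - (c.2.1 q - c.2.2 q) := by
    intro q
    have hq := (mem_posBall.1 q.2).2
    have h1 := sum_foldCoef_eval hm hx ⟨q.1, mem_latticeBall_of_posBall q⟩
    have h2 := sum_foldCoef_eval hm hx ⟨-q.1, neg_mem_latticeBall_of_posBall q⟩
    -- The group of `q` yields the cosine wave. The otherwise idle group of `-q` has phase `1/4` and
    -- yields `triSin (-(q · x))`, whence the opposite sign of the sine weights.
    simp only [phase, if_pos hq, if_neg hq.not_neg, sub_zero, ← triSin_eq_triCos, dotZ_neg,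
      triSin_neg] at h1 h2
    simp only [Finset.sum_mul]
    rw [Finset.sum_comm]
    have h3 : ∀ i, ∑ a,
        ((if a = (neuronEquiv R d).symm (⟨-q.1, neg_mem_latticeBall_of_posBall q⟩, i) then
          4 * foldCoef i else 0) * c.2.2 q -
        (if a = (neuronEquiv R d).symm (⟨q.1, mem_latticeBall_of_posBall q⟩, i) then
          4 * foldCoef i else 0) * c.2.1 q) * (waveLayers R d m).eval x a =
        4 * c.2.2 q * (foldCoef i * (waveLayers R d m).eval x
          ((neuronEquiv R d).symm (⟨-q.1, neg_mem_latticeBall_of_posBall q⟩, i))) -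
        4 * c.2.1 q * (foldCoef i * (waveLayers R d m).eval x
          ((neuronEquiv R d).symm (⟨q.1, mem_latticeBall_of_posBall q⟩, i))) := by
      intro i
      simp only [sub_mul, ite_mul, zero_mul, Finset.sum_sub_distrib, Finset.sum_ite_eq',
        Finset.mem_univ, if_true]
      ring
    simp only [h3]
    rw [Finset.sum_sub_distrib, ← Finset.mul_sum, ← Finset.mul_sum, h1, h2]
    ring
  rw [ReLUNetwork.eval, partialSum]
  simp only [waveNetwork]
  rw [Finset.sum_congr rfl fun a _ => Finset.sum_mul _ _ _, Finset.sum_comm,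
    Finset.sum_congr rfl fun q _ => h q, Finset.sum_sub_distrib]
  ring

theorem exists_depth {R : ℝ} (hR : 1 ≤ R) (hd : 1 ≤ d) :
    ∃ m : ℕ, R ^ 2 + 1 / 4 ≤ 4 ^ m ∧
      ((m + 1 : ℕ) : ℝ) ≤ 4 + Real.logb 2 (R * Real.sqrt (min R (d : ℝ))) := by
  have h0 : 0 ≤ Real.logb 2 R := Real.logb_nonneg one_lt_two hR
  -- This gives `4 ^ m ≥ 4 * R ^ 2`, with room for the phase, and `m + 1 ≤ 3 + log₂ R`. The factor
  -- `√(min R d) ≥ 1` in the bound is not exploited.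
  refine ⟨2 + ⌊Real.logb 2 R⌋₊, ?_, ?_⟩
  · have h1 : Real.logb 2 R < ⌊Real.logb 2 R⌋₊ + 1 := Nat.lt_floor_add_one _
    have h2 : R ≤ 2 ^ (⌊Real.logb 2 R⌋₊ + 1) := by
      rw [Real.logb_lt_iff_lt_rpow one_lt_two (by linarith)] at h1
      exact_mod_cast h1.le
    have h3 : (4 : ℝ) ^ (2 + ⌊Real.logb 2 R⌋₊) = 4 * (2 ^ (⌊Real.logb 2 R⌋₊ + 1)) ^ 2 := by
      rw [show (4 : ℝ) = 2 ^ 2 by norm_num, ← pow_mul, ← pow_mul, ← pow_add]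
      congr 1
      ring
    rw [h3]
    nlinarith
  · have h1 : (⌊Real.logb 2 R⌋₊ : ℝ) ≤ Real.logb 2 R := Nat.floor_le h0
    have h2 : 1 ≤ Real.sqrt (min R (d : ℝ)) :=
      Real.one_le_sqrt.2 (le_min hR (by exact_mod_cast hd))
    have h3 : Real.logb 2 R ≤ Real.logb 2 (R * Real.sqrt (min R (d : ℝ))) :=
      Real.logb_le_logb_of_le one_lt_two (by linarith)
        (le_mul_of_one_le_right (by linarith) h2)
    push_cast
    linarith

end Network

end ReLUApprox

/-! ### Assembly of the expansion and the network. -/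

theorem mainTheorem3 (s : ℝ) (hs0 : 0 < s) (hs1 : s < 1) :
    ∃ C : ℝ, 0 < C ∧ ∀ (d : ℕ) (ε : ℝ), 1 ≤ d → 0 < ε → ε < 1 →
      ∀ R : ℝ, R = (C / ε) ^ (1 / s) →
        ∃ L : ℕ, 1 ≤ L ∧ (L : ℝ) ≤ 4 + Real.logb 2 (R * Real.sqrt (min R (d : ℝ))) ∧
          ∃ 𝒩 : ReLUApprox.TriCoeffs R d →
              ReLUApprox.ReLUNetwork d (4 * ReLUApprox.latticeCount R d) L,
            -- only the output layer depends on the coefficients, and it does so linearly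
            (∀ c c', (𝒩 c).toHiddenLayers = (𝒩 c').toHiddenLayers) ∧
            IsLinearMap ℝ (fun c => ((𝒩 c).outWeight, (𝒩 c).outBias)) ∧
            -- the network reproduces the partial sum with these coefficients
            (∀ c, ∀ x ∈ ReLUApprox.cube d, (𝒩 c).eval x = ReLUApprox.partialSum c x) ∧
            ∀ f : (Fin d → ℝ) → ℝ, ReLUApprox.MemSobolev s f →
              ∃ (α₀ : ℝ) (α β : (Fin d → ℤ) → ℝ), ReLUApprox.HasTriExpansion f α₀ α β ∧
                ReLUApprox.l2Norm
                    (fun x => f x - (𝒩 (ReLUApprox.truncate R α₀ α β)).eval x) ≤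
                  ENNReal.ofReal (ε * ReLUApprox.sobolevNorm s f) := by
  have hC := ReLUApprox.one_le_rateConst hs1
  refine ⟨ReLUApprox.rateConst s, by linarith, fun d ε hd hε hε1 R hR => ?_⟩
  have hCε : 1 ≤ ReLUApprox.rateConst s / ε := by
    rw [one_le_div hε]
    linarith
  have hR1 : 1 ≤ R := hR ▸ Real.one_le_rpow hCε (by positivity)
  -- The radius is chosen so that the truncation rate is exactly `ε`.
  have hRs : ReLUApprox.rateConst s / R ^ s = ε := by
    rw [hR, ← Real.rpow_mul (by linarith), one_div_mul_cancel hs0.ne', Real.rpow_one]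
    field_simp
  obtain ⟨m, hm, hL⟩ := ReLUApprox.exists_depth hR1 hd
  refine ⟨m + 1, by omega, hL, ReLUApprox.waveNetwork R d m, fun _ _ => rfl,
    ReLUApprox.isLinearMap_waveNetwork R d m,
    fun c x hx => ReLUApprox.eval_waveNetwork hm c hx, fun f hf => ?_⟩
  refine ⟨_, _, _, ReLUApprox.hasTriExpansion_triCoef f hf.memLp, ?_⟩
  rw [← hRs]
  refine le_of_eq_of_le ?_
    (ReLUApprox.l2Norm_sub_partialSum_le f hs0 hs1 (by linarith : 0 < R) hf)
  -- Network and partial sum agree only on the cube, which suffices for the restricted measure.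
  refine eLpNorm_congr_ae ?_
  filter_upwards [ae_restrict_mem (measurableSet_Icc : MeasurableSet (ReLUApprox.cube d))] with x hx
  rw [ReLUApprox.eval_waveNetwork hm _ hx]
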